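/- Let $\Bbbk$ be an algebraically closed field of characteristic zero. For $h\in\Bbbk[x]$ let $A_h=\Bbbk[x][t;\,h\,\partial_x]$ be the differential Ore extension, i.e. the $\Bbbk$-algebra generated by $x$ and $t$ subject to $tx=xt+h(x)$, and let $\mathrm{Aut}(A_h)$ be its group of $\Bbbk$-algebra automorphisms under composition. Let $h=\sum_{i=0}^{N}c_ix^i$ be of degree $N\ge 1$ and normalized, that is, $c_N=1$ and $c_{N-1}=0$, and let $\mathcal S_h=\{i : c_i\ne 0\}$. For $n\ge 1$ let $\mathbb G_n=\{a\in\Bbbk^* : a^n=1\}$, and put $\mathbb G_0=\Bbbk^*$. Identify $r\in\Bbbk[x]$ with $\sigma_r$, where $\sigma_r(x)=x$ and $\sigma_r(t)=t+r(x)$, and identify $a\in\Bbbk^*$ with $\tau_a$, where $\tau_a(x)=ax$ and $\tau_a(t)=a^{N-1}t$. For a subgroup $G\le\Bbbk^*$, write $\mathrm{Aut}(A_h)=\Bbbk[x]\rtimes G$ if $\sigma_r$ ($r\in\Bbbk[x]$) and $\tau_a$ ($a\in G$) define automorphisms of $A_h$ and $(r,a)\mapsto\sigma_r\circ\tau_a$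 is a group isomorphism from $\Bbbk[x]\rtimes G$ onto $\mathrm{Aut}(A_h)$, where $a\in G$ acts on the additive group $\Bbbk[x]$ by $r(x)\mapsto a^{1-N}r(ax)$. Then: i) if $h=x^N$, then $\mathrm{Aut}(A_h)=\Bbbk[x]\rtimes\Bbbk^*$; ii) if $h\ne x^N$, then $$\mathrm{Aut}(A_h)=\Bbbk[x]\rtimes\Bigl(\bigcap_{i\in\mathcal S_h}\mathbb G_{N-i}\Bigr)=\Bbbk[x]\rtimes\mathbb G_g,\qquad g=\gcd\{N-i : i\in\mathcal S_h,\ i\ne N\},$$ where in particular $\bigcap_{i\in\mathcal S_h}\mathbb G_{N-i}=\mathbb G_g$. -/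

import Mathlib

open Polynomial

/-- The defining relation `t x = x t + h(x)` on the free algebra on two letters;
the letter `0` is `x` and the letter `1` is `t`. -/
inductive OreRel {k : Type*} [Field k] (h : k[X]) :
    FreeAlgebra k (Fin 2) → FreeAlgebra k (Fin 2) → Prop
  | rel : OreRel h
      (FreeAlgebra.ι k 1 * FreeAlgebra.ι k 0)
      (FreeAlgebra.ι k 0 * FreeAlgebra.ι k 1 + aeval (FreeAlgebra.ι k (0 : Fin 2)) h)

/-- The differential Ore extension `A_h = k[x][t; h ∂ₓ]`: the `k`-algebra generated by `x` and `t`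
subject to `t x = x t + h(x)`. -/
abbrev OreAlg {k : Type*} [Field k] (h : k[X]) : Type _ := RingQuot (OreRel h)

/-- The generator `x` of `A_h`. -/
noncomputable def OreAlg.x {k : Type*} [Field k] (h : k[X]) : OreAlg h :=
  RingQuot.mkAlgHom k (OreRel h) (FreeAlgebra.ι k 0)

/-- The generator `t` of `A_h`. -/
noncomputable def OreAlg.t {k : Type*} [Field k] (h : k[X]) : OreAlg h :=
  RingQuot.mkAlgHom k (OreRel h) (FreeAlgebra.ι k 1)

/-- The automorphism `r(x) ↦ a^(1-N) r(a x)` of the additive group of `k[x]`. -/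
noncomputable def dilation {k : Type*} [Field k] (N : ℕ) (a : kˣ) : k[X] ≃+ k[X] where
  toFun r := C ((a ^ (1 - (N : ℤ)) : kˣ) : k) * r.comp (C (a : k) * X)
  invFun r := C (((a⁻¹) ^ (1 - (N : ℤ)) : kˣ) : k) * r.comp (C ((a⁻¹ : kˣ) : k) * X)
  left_inv r := by
    simp only [mul_comp, C_comp, comp_assoc, X_comp, ← mul_assoc, ← C_mul, ← Units.val_mul,
      inv_zpow, inv_mul_cancel, mul_inv_cancel, Units.val_one, C_1, one_mul, comp_X]
  right_inv r := by
    simp only [mul_comp, C_comp, comp_assoc, X_comp, ← mul_assoc, ← C_mul, ← Units.val_mul,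
      inv_zpow, inv_mul_cancel, mul_inv_cancel, Units.val_one, C_1, one_mul, comp_X]
  map_add' r s := by rw [add_comp, mul_add]

/-- The action of `k*` on the additive group `k[x]` in which `a` sends `r(x)` to
`a^(1-N) r(a x)`. -/
noncomputable def dilationAction (k : Type*) [Field k] (N : ℕ) :
    kˣ →* MulAut (Multiplicative k[X]) where
  toFun a := AddEquiv.toMultiplicative (dilation N a)
  map_one' := by
    ext r : 1
    change Multiplicative.ofAdd (dilation N 1 r.toAdd) = r
    simp [dilation]
  map_mul' a b := by
    ext r : 1
    change Multiplicative.ofAdd (dilation N (a * b) r.toAdd)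
      = Multiplicative.ofAdd (dilation N a (dilation N b r.toAdd))
    congr 1
    simp only [dilation, AddEquiv.coe_mk, Equiv.coe_fn_mk, mul_comp, C_comp, comp_assoc, X_comp,
      mul_zpow, Units.val_mul, C_mul]
    rw [mul_comm (C (b : k)) , ← mul_assoc, mul_comm (C (a : k)) (C (b : k))]
    ring_nf

/-- `Aut(A_h) = k[x] ⋊ G`, where the group `G` maps to `k*` by `ι` (an inclusion below).
The element `r` of `k[x]` is identified with the automorphism `σ_r : x ↦ x, t ↦ t + r(x)`, and the
element `a` of `G` with `τ_a : x ↦ a x, t ↦ a^(N-1) t`, where `N` is the degree of `h`; the group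
law on `Aut(A_h)` is composition, so that `(r, a)` is `σ_r ∘ τ_a`. -/
def AutEqSemidirect {k : Type*} [Field k] (h : k[X]) {G : Type*} [Group G] (ι : G →* kˣ) : Prop :=
  ∃ e : Multiplicative k[X] ⋊[(dilationAction k h.natDegree).comp ι] G ≃*
      (OreAlg h ≃ₐ[k] OreAlg h),
    (∀ r : k[X],
      e (SemidirectProduct.inl (Multiplicative.ofAdd r)) (OreAlg.x h) = OreAlg.x h ∧
      e (SemidirectProduct.inl (Multiplicative.ofAdd r)) (OreAlg.t h)
        = OreAlg.t h + aeval (OreAlg.x h) r) ∧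
    (∀ a : G,
      e (SemidirectProduct.inr a) (OreAlg.x h) = (ι a : k) • OreAlg.x h ∧
      e (SemidirectProduct.inr a) (OreAlg.t h) = (ι a : k) ^ (h.natDegree - 1) • OreAlg.t h)

/-!
The algebra `A_h` acts on `k[x][y]`, `x` by multiplication and `t` by `y + h ∂ₓ`. Applying an element
to `1` gives its normal form (`OreAlg.symbol`), which identifies `A_h` with `k[x][y]` as a left
`k[x]`-module. Leading coefficients in `y` multiply (`OreAlg.symbol_mul_leading`), so that `A_h` is a
domain with an additive degree in `t`.

Let `φ` be an automorphism. The commutators of `A_h` generate the two-sided ideal `h A_h`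
(`OreAlg.exists_commutator_eq`), so `φ` preserves this ideal and `φ(h)` is `h` times a unit. Units
have degree `0` in `t`, and `φ(h) = h(φ(x))` has degree `N` times that of `φ(x)`; as `N ≥ 1`, the
element `φ(x)` lies in `k[x]`. The same holds for the inverse of `φ`, so that `φ(x) = a x + b`. Now
`h(a x + b)` is a scalar multiple of `h`, and in characteristic zero the vanishing of the coefficient
of degree `N - 1` forces `b = 0` (`OreAlg.eq_zero_of_comp_eq_smul`). Since `t` is a polynomial in
`φ(t)` over `k[x]`, the degree of `φ(t)` is `1`, and the relation `t x = x t + h` makes its leading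
coefficient `a^(N-1)`. Hence `φ = σ_r ∘ τ_a`, where `h(a x) = a^N h(x)` (`OreAlg.exists_map_eq`);
comparing coefficients, this condition says that `a` is an `(N - i)`-th root of unity for each `i` in
the support of `h`. Conversely, each such pair `(r, a)` gives an automorphism, by the universal
property of `A_h`.
-/

namespace OreAlg

/-! ### Generators and relations -/

variable {k : Type*} [Field k] (h : k[X])

theorem t_mul_x : t h * x h = x h * t h + aeval (x h) h := by
  have e := RingQuot.mkAlgHom_rel k (OreRel.rel (h := h))
  rw [map_mul, map_add, map_mul, ← aeval_algHom_apply] at e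
  exact e

/-- The universal property of `A_h`. -/
noncomputable def lift {B : Type*} [Ring B] [Algebra k B] (b c : B)
    (hbc : c * b = b * c + aeval b h) : OreAlg h →ₐ[k] B :=
  RingQuot.liftAlgHom k ⟨FreeAlgebra.lift k ![b, c], by
    rintro _ _ ⟨⟩
    simpa [← aeval_algHom_apply] using hbc⟩

section Lift

variable {B : Type*} [Ring B] [Algebra k B] (b c : B) (hbc : c * b = b * c + aeval b h)

@[simp] theorem lift_x : lift h b c hbc (x h) = b := by
  simp [lift, x]

@[simp] theorem lift_t : lift h b c hbc (t h) = c := by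
  simp [lift, t]

variable {h} in
theorem algHom_ext {f g : OreAlg h →ₐ[k] B} (hx : f (x h) = g (x h)) (ht : f (t h) = g (t h)) :
    f = g := by
  apply RingQuot.ringQuot_ext'
  ext i
  fin_cases i
  · exact hx
  · exact ht

end Lift

variable {h} in
theorem induction {P : OreAlg h → Prop} (hC : ∀ c : k, P (algebraMap k _ c)) (hx : P (x h))
    (ht : P (t h)) (hadd : ∀ u v, P u → P v → P (u + v)) (hmul : ∀ u v, P u → P v → P (u * v))
    (u : OreAlg h) : P u := by
  obtain ⟨u, rfl⟩ := RingQuot.mkAlgHom_surjective k (OreRel h) u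
  induction u using FreeAlgebra.induction with
  | grade0 c => simpa using hC c
  | grade1 i =>
    fin_cases i
    · exact hx
    · exact ht
  | mul u v hu hv => rw [map_mul]; exact hmul _ _ hu hv
  | add u v hu hv => rw [map_add]; exact hadd _ _ hu hv

theorem t_mul_aeval (p : k[X]) :
    t h * aeval (x h) p = aeval (x h) p * t h + aeval (x h) (h * derivative p) := by
  induction p using Polynomial.induction_on' with
  | add p q hp hq => simp only [map_add, mul_add, add_mul, hp, hq]; abel
  | monomial n c =>
    induction n with
    | zero => simp [Algebra.commutes]
    | succ n ih =>
      rw [← monomial_mul_X, map_mul, aeval_X, ← mul_assoc, ih, add_mul, mul_assoc, t_mul_x,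
        mul_add, ← mul_assoc, derivative_mul, derivative_X, mul_one, mul_add]
      have : aeval (x h) (h * derivative (monomial n c)) * x h
          = aeval (x h) (h * (derivative (monomial n c) * X)) := by
        rw [← mul_assoc, map_mul _ _ X, aeval_X]
      rw [this, map_add, ← map_mul, mul_comm _ h]
      abel

/-! ### Normal forms and the degree in `t` -/

/-- The derivation `∂ₓ` of `k[x][y]`, acting on the coefficients of powers of `y`. -/
noncomputable def coeffDerivative : k[X][X] →ₗ[k] k[X][X] where
  toFun v := v.sum fun n p => monomial n (derivative p)
  map_add' v w := sum_add_index _ _ _ (by simp) (by simp)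
  map_smul' c v := by
    rw [sum_smul_index' _ _ _ (by simp), RingHom.id_apply]
    simp only [sum_def, Finset.smul_sum, derivative_smul, smul_monomial]

@[simp] theorem coeff_coeffDerivative (v : k[X][X]) (n : ℕ) :
    (coeffDerivative v).coeff n = derivative (v.coeff n) := by
  simp [coeffDerivative, sum_def, coeff_monomial]
  intro hn; simp [hn]

@[simp] theorem coeffDerivative_monomial (n : ℕ) (p : k[X]) :
    coeffDerivative (monomial n p) = monomial n (derivative p) := by
  ext1 i; simp [coeff_monomial]; split_ifs <;> simp

theorem coeffDerivative_C_mul (p : k[X]) (v : k[X][X]) :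
    coeffDerivative (C p * v) = C (derivative p) * v + C p * coeffDerivative v := by
  ext1 i; simp

/-- The left regular representation of `A_h`, written on `k[x][y]` through the normal form
`∑ pᵢ(x) yⁱ ↔ ∑ pᵢ(x) tⁱ`: `x` acts by multiplication and `t` by `y + h ∂ₓ`. -/
noncomputable def regularRep : OreAlg h →ₐ[k] Module.End k k[X][X] :=
  lift h (B := Module.End k k[X][X]) (LinearMap.mulLeft k (C X))
    (LinearMap.mulLeft k X + LinearMap.mulLeft k (C h) ∘ₗ coeffDerivative) (by
      have key (p : k[X]) : aeval (R := k) (A := Module.End k k[X][X])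
          (LinearMap.mulLeft k (C X)) p = LinearMap.mulLeft k (C p) := by
        have := aeval_algHom_apply (Algebra.lmul k k[X][X]) (C X) p
        have e : aeval (C X : k[X][X]) p = C p := by
          have := aeval_algHom_apply (CAlgHom (R := k) (A := k[X])) X p
          simpa using this
        rw [e] at this
        exact this
      rw [key]
      ext1 v
      simp only [Module.End.mul_apply, LinearMap.add_apply, LinearMap.comp_apply,
        LinearMap.mulLeft_apply, coeffDerivative_C_mul, derivative_X, C_1]
      ring)

@[simp] theorem regularRep_aeval_x (p : k[X]) (v : k[X][X]) :
    regularRep h (aeval (x h) p) v = C p * v := by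
  induction p using Polynomial.induction_on' generalizing v with
  | add p q hp hq => simp only [map_add, add_mul, LinearMap.add_apply, hp, hq]
  | monomial n c =>
    induction n generalizing v with
    | zero => simp [Algebra.smul_def, Module.algebraMap_end_apply]
    | succ n ih =>
      rw [← monomial_mul_X, map_mul, aeval_X, map_mul, Module.End.mul_apply, ih, C_mul, mul_assoc]
      simp [regularRep]

@[simp] theorem regularRep_t (v : k[X][X]) :
    regularRep h (t h) v = X * v + C h * coeffDerivative v := by
  simp [regularRep]

/-- The normal form of an element of `A_h`: the polynomial `∑ pᵢ(x) yⁱ` for `∑ pᵢ(x) tⁱ`. -/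
noncomputable def symbol : OreAlg h →ₗ[k] k[X][X] :=
  LinearMap.applyₗ 1 ∘ₗ (regularRep h).toLinearMap

theorem symbol_mul (u v : OreAlg h) : symbol h (u * v) = regularRep h u (symbol h v) := by
  simp [symbol, Module.End.mul_apply]

@[simp] theorem symbol_aeval_x_mul (p : k[X]) (u : OreAlg h) :
    symbol h (aeval (x h) p * u) = C p * symbol h u := by
  rw [symbol_mul, regularRep_aeval_x]

@[simp] theorem symbol_aeval_x (p : k[X]) : symbol h (aeval (x h) p) = C p := by
  simp [symbol]

@[simp] theorem symbol_one : symbol h 1 = 1 := by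
  simp [symbol]

@[simp] theorem symbol_t : symbol h (t h) = X := by
  have : coeffDerivative (1 : k[X][X]) = 0 := by
    rw [← monomial_zero_one, coeffDerivative_monomial, derivative_one, monomial_zero_right]
  simp [symbol, this]

theorem aeval_x_injective : Function.Injective (aeval (x h) : k[X] →ₐ[k] OreAlg h) := by
  intro p q e
  simpa using congrArg (symbol h) e

/-- The evaluation `y ↦ t`, with coefficients on the left, is `A_h`-linear. -/
theorem eval₂_regularRep (u : OreAlg h) (v : k[X][X]) :
    eval₂ (aeval (x h) : k[X] →ₐ[k] OreAlg h).toRingHom (t h) (regularRep h u v)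
      = u * eval₂ (aeval (x h) : k[X] →ₐ[k] OreAlg h).toRingHom (t h) v := by
  have hC (p : k[X]) (v : k[X][X]) :
      eval₂ (aeval (x h) : k[X] →ₐ[k] OreAlg h).toRingHom (t h) (C p * v)
        = aeval (x h) p * eval₂ (aeval (x h) : k[X] →ₐ[k] OreAlg h).toRingHom (t h) v := by
    induction v using Polynomial.induction_on' with
    | add v w hv hw => rw [mul_add, eval₂_add, eval₂_add, mul_add, hv, hw]
    | monomial n q => simp [C_mul_monomial, eval₂_monomial, mul_assoc]
  induction u using OreAlg.induction generalizing v with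
  | hC c =>
    have := regularRep_aeval_x h (C c) v
    rw [aeval_C] at this
    rw [this, hC, aeval_C]
  | hx =>
    have := regularRep_aeval_x h X v
    rw [aeval_X] at this
    rw [this, hC, aeval_X]
  | ht =>
    rw [regularRep_t, eval₂_add, hC]
    induction v using Polynomial.induction_on' with
    | add v w hv hw =>
      rw [mul_add, eval₂_add, map_add, eval₂_add, mul_add, eval₂_add, mul_add, ← hv, ← hw]
      abel
    | monomial n q =>
      rw [X_mul_monomial, coeffDerivative_monomial]
      have := t_mul_aeval h q
      simp only [eval₂_monomial, AlgHom.toRingHom_eq_coe, RingHom.coe_coe]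
      rw [← mul_assoc (t h), this, map_mul, add_mul, pow_succ', mul_assoc, mul_assoc]
  | hadd u w hu hw => rw [map_add, LinearMap.add_apply, eval₂_add, hu, hw, add_mul]
  | hmul u w hu hw => rw [map_mul, Module.End.mul_apply, hu, hw, mul_assoc]

/-- Every element of `A_h` is recovered from its normal form. -/
theorem eval₂_symbol (u : OreAlg h) :
    eval₂ (aeval (x h) : k[X] →ₐ[k] OreAlg h).toRingHom (t h) (symbol h u) = u := by
  have := eval₂_regularRep h u 1
  rwa [eval₂_one, mul_one] at this

theorem symbol_injective : Function.Injective (symbol h) :=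
  Function.LeftInverse.injective (eval₂_symbol h)

@[simp] theorem symbol_eq_zero_iff {u : OreAlg h} : symbol h u = 0 ↔ u = 0 :=
  map_eq_zero_iff _ (symbol_injective h)

theorem exists_eq_aeval_of_natDegree_symbol_eq_zero {u : OreAlg h}
    (hu : (symbol h u).natDegree = 0) : ∃ p : k[X], u = aeval (x h) p := by
  obtain ⟨p, hp⟩ := natDegree_eq_zero.mp hu
  exact ⟨p, symbol_injective h (by rw [symbol_aeval_x, hp])⟩

theorem regularRep_t_pow_leading (i : ℕ) {m : ℕ} {v : k[X][X]} (hv : v.natDegree ≤ m) :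
    (regularRep h (t h ^ i) v).natDegree ≤ i + m ∧
      (regularRep h (t h ^ i) v).coeff (i + m) = v.coeff m := by
  induction i with
  | zero => simpa using hv
  | succ i ih =>
    rw [pow_succ', map_mul, Module.End.mul_apply, regularRep_t]
    set w := regularRep h (t h ^ i) v
    have hw (j : ℕ) (hj : i + m < j) : w.coeff j = 0 :=
      coeff_eq_zero_of_natDegree_lt (ih.1.trans_lt hj)
    refine ⟨natDegree_le_iff_coeff_eq_zero.mpr fun j hj => ?_, ?_⟩
    · obtain ⟨j, rfl⟩ : ∃ l, j = l + 1 := ⟨j - 1, by omega⟩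
      simp [coeff_X_mul, hw j (by omega), hw (j + 1) (by omega)]
    · rw [show i + 1 + m = i + m + 1 by ring]
      simp [coeff_X_mul, hw (i + m + 1) (by omega), ih.2]

/-- The commutation rule changes only terms of lower degree in `t`, so the leading term of a product
is the product of the leading terms. -/
theorem symbol_mul_leading {u v : OreAlg h} {n m : ℕ} (hu : (symbol h u).natDegree ≤ n)
    (hv : (symbol h v).natDegree ≤ m) :
    (symbol h (u * v)).natDegree ≤ n + m ∧
      (symbol h (u * v)).coeff (n + m) = (symbol h u).coeff n * (symbol h v).coeff m := by
  have e : symbol h (u * v) = ∑ i ∈ Finset.range (n + 1),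
      C ((symbol h u).coeff i) * regularRep h (t h ^ i) (symbol h v) := by
    conv_lhs => rw [symbol_mul, ← eval₂_symbol h u, eval₂_eq_sum_range' _ (Nat.lt_succ_of_le hu)]
    rw [map_sum, LinearMap.sum_apply]
    refine Finset.sum_congr rfl fun i _ => ?_
    rw [map_mul, Module.End.mul_apply]
    exact regularRep_aeval_x h _ _
  rw [e]
  refine ⟨natDegree_sum_le_of_forall_le _ _ fun i hi => ?_, ?_⟩
  · refine (natDegree_C_mul_le _ _).trans ((regularRep_t_pow_leading h i hv).1.trans ?_)
    have := Finset.mem_range.mp hi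
    omega
  · rw [finsetSum_coeff, Finset.sum_range_succ, Finset.sum_eq_zero, zero_add, coeff_C_mul,
      (regularRep_t_pow_leading h n hv).2]
    intro i hi
    have := Finset.mem_range.mp hi
    rw [coeff_C_mul, coeff_eq_zero_of_natDegree_lt
      ((regularRep_t_pow_leading h i hv).1.trans_lt (by omega)), mul_zero]

instance : NoZeroDivisors (OreAlg h) where
  eq_zero_or_eq_zero_of_mul_eq_zero {u v} e := by
    have := (symbol_mul_leading h (le_refl (symbol h u).natDegree)
      (le_refl (symbol h v).natDegree)).2
    rw [e, map_zero, coeff_zero] at this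
    simpa using this.symm

theorem natDegree_symbol_mul {u v : OreAlg h} (hu : u ≠ 0) (hv : v ≠ 0) :
    (symbol h (u * v)).natDegree = (symbol h u).natDegree + (symbol h v).natDegree := by
  obtain ⟨h1, h2⟩ := symbol_mul_leading h (le_refl (symbol h u).natDegree)
    (le_refl (symbol h v).natDegree)
  refine le_antisymm h1 (le_natDegree_of_ne_zero ?_)
  rw [h2]
  exact mul_ne_zero (by simpa using hu) (by simpa using hv)

theorem symbol_pow_leading (u : OreAlg h) (i : ℕ) :
    (symbol h (u ^ i)).natDegree ≤ i * (symbol h u).natDegree ∧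
      (symbol h (u ^ i)).coeff (i * (symbol h u).natDegree)
        = (symbol h u).leadingCoeff ^ i := by
  induction i with
  | zero => simp
  | succ i ih =>
    have := symbol_mul_leading h ih.1 (le_refl (symbol h u).natDegree)
    rw [← pow_succ, ih.2, ← Nat.succ_mul] at this
    exact ⟨this.1, by rw [this.2, pow_succ]; rfl⟩

/-- Degrees multiply under the substitution `y ↦ u` in `k[x][y]`. If `u` has degree `0`, both sides
vanish, although leading terms may cancel. -/
theorem natDegree_symbol_eval₂ (u : OreAlg h) (v : k[X][X]) :
    (symbol h (eval₂ (aeval (x h) : k[X] →ₐ[k] OreAlg h).toRingHom u v)).natDegree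
      = v.natDegree * (symbol h u).natDegree := by
  set d := (symbol h u).natDegree with hd
  have e : symbol h (eval₂ (aeval (x h) : k[X] →ₐ[k] OreAlg h).toRingHom u v)
      = ∑ i ∈ Finset.range (v.natDegree + 1), C (v.coeff i) * symbol h (u ^ i) := by
    rw [eval₂_eq_sum_range, map_sum]
    exact Finset.sum_congr rfl fun i _ => symbol_aeval_x_mul h _ _
  have hle : (symbol h (eval₂ (aeval (x h) : k[X] →ₐ[k] OreAlg h).toRingHom u v)).natDegree
      ≤ v.natDegree * d := by
    rw [e]
    refine natDegree_sum_le_of_forall_le _ _ fun i hi => ?_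
    refine (natDegree_C_mul_le _ _).trans ((symbol_pow_leading h u i).1.trans ?_)
    exact Nat.mul_le_mul_right _ (Nat.lt_succ_iff.mp (Finset.mem_range.mp hi))
  rcases Nat.eq_zero_or_pos d with h0 | hpos
  · rw [h0, mul_zero] at hle ⊢
    exact Nat.le_zero.mp hle
  by_cases hv : v = 0
  · simp [hv]
  have hu : symbol h u ≠ 0 := by
    rintro h0
    simp [hd, h0] at hpos
  refine le_antisymm hle (le_natDegree_of_ne_zero ?_)
  rw [e, finsetSum_coeff, Finset.sum_range_succ, Finset.sum_eq_zero, zero_add, coeff_C_mul,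
    (symbol_pow_leading h u _).2]
  · exact mul_ne_zero (by simpa using hv) (pow_ne_zero _ (by simpa using hu))
  · intro i hi
    rw [coeff_C_mul, coeff_eq_zero_of_natDegree_lt ((symbol_pow_leading h u i).1.trans_lt
      (Nat.mul_lt_mul_of_pos_right (Finset.mem_range.mp hi) hpos)), mul_zero]

theorem natDegree_symbol_aeval (u : OreAlg h) (p : k[X]) :
    (symbol h (aeval u p)).natDegree = p.natDegree * (symbol h u).natDegree := by
  rw [← natDegree_map_eq_of_injective (C_injective (R := k)) p, ← natDegree_symbol_eval₂,
    eval₂_map, aeval_def]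
  congr 3
  ext c
  simp

/-! ### Commutators -/

/-- Every commutator lies in `h A_h`: the right ideal `h A_h` is two-sided, since
`t h = h (t + h')`, and it contains the commutators of the generators. -/
theorem exists_commutator_eq (u v : OreAlg h) : ∃ b, u * v = v * u + aeval (x h) h * b := by
  -- `h A_h` is stable under left multiplication
  have left (u b : OreAlg h) : ∃ c, u * (aeval (x h) h * b) = aeval (x h) h * c := by
    induction u using OreAlg.induction generalizing b with
    | hC c => exact ⟨algebraMap k _ c * b, by rw [← mul_assoc, Algebra.commutes, mul_assoc]⟩
    | hx =>
      refine ⟨x h * b, ?_⟩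
      have : x h * aeval (x h) h = aeval (x h) h * x h := by
        have := congrArg (aeval (x h)) (mul_comm X h)
        simpa using this
      rw [← mul_assoc, this, mul_assoc]
    | ht =>
      exact ⟨(t h + aeval (x h) (derivative h)) * b, by
        rw [← mul_assoc, t_mul_aeval, map_mul, ← mul_add, mul_assoc]⟩
    | hadd u v hu hv =>
      obtain ⟨c, hc⟩ := hu b
      obtain ⟨d, hd⟩ := hv b
      exact ⟨c + d, by rw [add_mul, hc, hd, mul_add]⟩
    | hmul u v hu hv =>
      obtain ⟨c, hc⟩ := hv b
      obtain ⟨d, hd⟩ := hu c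
      exact ⟨d, by rw [mul_assoc, hc, hd]⟩
  -- for fixed `v`, the condition on `u` is stable under sums and products, so that it suffices
  -- to check it on generators
  have step (v : OreAlg h) (hx : ∃ b, x h * v = v * x h + aeval (x h) h * b)
      (ht : ∃ b, t h * v = v * t h + aeval (x h) h * b) (u : OreAlg h) :
      ∃ b, u * v = v * u + aeval (x h) h * b := by
    induction u using OreAlg.induction with
    | hC c => exact ⟨0, by rw [Algebra.commutes, mul_zero, add_zero]⟩
    | hx => exact hx
    | ht => exact ht
    | hadd u w hu hw =>
      obtain ⟨c, hc⟩ := hu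
      obtain ⟨d, hd⟩ := hw
      exact ⟨c + d, by rw [add_mul, hc, hd, mul_add, mul_add]; abel⟩
    | hmul u w hu hw =>
      obtain ⟨c, hc⟩ := hu
      obtain ⟨d, hd⟩ := hw
      obtain ⟨e, he⟩ := left u d
      exact ⟨c * w + e, by
        rw [mul_assoc, hd, mul_add, he, ← mul_assoc, hc, add_mul, mul_add, add_assoc, mul_assoc,
          mul_assoc]⟩
  have flip {u v : OreAlg h} (huv : ∃ b, u * v = v * u + aeval (x h) h * b) :
      ∃ b, v * u = u * v + aeval (x h) h * b := by
    obtain ⟨b, hb⟩ := huv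
    refine ⟨(-1 : k) • b, ?_⟩
    have : aeval (x h) h * b + (-1 : k) • (aeval (x h) h * b) = 0 := by
      nth_rw 1 [← one_smul k (aeval (x h) h * b)]
      rw [← add_smul, add_neg_cancel, zero_smul]
    rw [hb, mul_smul_comm, add_assoc, this, add_zero]
  have tx : ∃ b, t h * x h = x h * t h + aeval (x h) h * b := ⟨1, by rw [t_mul_x, mul_one]⟩
  have self (u : OreAlg h) : ∃ b, u * u = u * u + aeval (x h) h * b := ⟨0, by simp⟩
  exact step v (flip (step _ (self _) tx v)) (flip (step _ (flip tx) (self _) v)) u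

/-! ### The shape of an automorphism -/

variable {h}

theorem map_t_mul_map_x (φ : OreAlg h ≃ₐ[k] OreAlg h) :
    φ (t h) * φ (x h) = φ (x h) * φ (t h) + φ (aeval (x h) h) := by
  rw [← map_mul, ← map_mul, ← map_add, t_mul_x]

theorem aeval_x_ne_zero {p : k[X]} (hp : p ≠ 0) : aeval (x h) p ≠ 0 :=
  (map_ne_zero_iff _ (aeval_x_injective h)).mpr hp

/-- An automorphism preserves the ideal `h A_h` generated by the commutators, hence multiplies the
element `h` by a unit. -/
theorem exists_map_h_eq_mul (hh : h ≠ 0) (φ : OreAlg h ≃ₐ[k] OreAlg h) :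
    ∃ b c, φ (aeval (x h) h) = aeval (x h) h * b ∧ b * c = 1 := by
  obtain ⟨b, hb⟩ := exists_commutator_eq h (φ (t h)) (φ (x h))
  obtain ⟨c, hc⟩ := exists_commutator_eq h (φ.symm (t h)) (φ.symm (x h))
  rw [map_t_mul_map_x] at hb hc
  replace hb := add_left_cancel hb
  replace hc := add_left_cancel hc
  refine ⟨b, φ c, hb, ?_⟩
  apply mul_left_cancel₀ (aeval_x_ne_zero hh)
  rw [← mul_assoc, ← hb, ← map_mul, ← hc, AlgEquiv.apply_symm_apply, mul_one]

/-- Since `φ(h) = h(φ(x))` is `h` times a unit, it has degree `0` in `t`; its degree is `N` times that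
of `φ(x)`. -/
theorem natDegree_symbol_map_x (hN : h.natDegree ≠ 0) (φ : OreAlg h ≃ₐ[k] OreAlg h) :
    (symbol h (φ (x h))).natDegree = 0 := by
  have hh : h ≠ 0 := by rintro rfl; simp at hN
  obtain ⟨b, c, hb, hbc⟩ := exists_map_h_eq_mul hh φ
  have h1 : (1 : OreAlg h) ≠ 0 := fun e => one_ne_zero (α := k[X][X]) (by
    rw [← symbol_one h, e, map_zero])
  have hb0 : b ≠ 0 := by rintro rfl; exact h1 (by rw [← hbc, zero_mul])
  have hc0 : c ≠ 0 := by rintro rfl; exact h1 (by rw [← hbc, mul_zero])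
  have hdeg := natDegree_symbol_mul h hb0 hc0
  rw [hbc, symbol_one, natDegree_one] at hdeg
  have h0 := aeval_x_ne_zero (h := h) hh
  have := congrArg (fun u => (symbol h u).natDegree) hb
  simp only [natDegree_symbol_mul h h0 hb0, symbol_aeval_x, natDegree_C] at this
  rw [← aeval_algHom_apply φ, natDegree_symbol_aeval] at this
  exact (Nat.mul_eq_zero.mp (by omega)).resolve_left hN

theorem exists_map_x_eq_aeval (hN : h.natDegree ≠ 0) (φ : OreAlg h ≃ₐ[k] OreAlg h) :
    ∃ p : k[X], φ (x h) = aeval (x h) p ∧ p.natDegree = 1 := by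
  obtain ⟨p, hp⟩ := exists_eq_aeval_of_natDegree_symbol_eq_zero h (natDegree_symbol_map_x hN φ)
  obtain ⟨q, hq⟩ :=
    exists_eq_aeval_of_natDegree_symbol_eq_zero h (natDegree_symbol_map_x hN φ.symm)
  refine ⟨p, hp, ?_⟩
  have : q.comp p = X := by
    apply aeval_x_injective h
    rw [aeval_comp, ← hp, aeval_X, aeval_algHom_apply φ, ← hq, AlgEquiv.apply_symm_apply]
  have hd := congrArg natDegree this
  rw [natDegree_comp, natDegree_X] at hd
  exact Nat.eq_one_of_mul_eq_one_left hd

/-- A monic polynomial of degree `N ≥ 1` without term of degree `N - 1` whose roots are permuted by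
an affine substitution: the substitution has no translation part, as it fixes the barycentre `0` of
the roots. -/
theorem eq_zero_of_comp_eq_smul [CharZero k] (hN : h.natDegree ≠ 0) (hmonic : h.Monic)
    (hcoeff : h.coeff (h.natDegree - 1) = 0) {a b c : k} (ha : a ≠ 0)
    (hab : h.comp (C a * X + C b) = C c * h) : b = 0 ∧ c = a ^ h.natDegree := by
  obtain ⟨n, hn⟩ := Nat.exists_eq_succ_of_ne_zero hN
  rw [hn, Nat.succ_sub_one] at hcoeff
  have hlead : h.coeff (n + 1) = 1 := by rw [← hmonic.coeff_natDegree, hn]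
  have key : h.comp (C a * X + C b) = (taylor b h).comp (C a * X) := by
    rw [taylor_apply, comp_assoc]; simp
  have co (i : ℕ) : (taylor b h).coeff i * a ^ i = c * h.coeff i := by
    rw [← comp_C_mul_X_coeff, ← key, hab, coeff_C_mul]
  have h2 : (hasseDeriv n h).coeff 1 = n + 1 := by
    rw [hasseDeriv_coeff, add_comm 1 n, hlead]; simp
  have h3 : (taylor b h).coeff n = (n + 1) * b := by
    rw [taylor_coeff, eval_eq_sum_range' (n := 2), Finset.sum_range_succ, Finset.sum_range_one,
      h2, hasseDeriv_coeff, zero_add, hcoeff]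
    · simp
    · exact (natDegree_hasseDeriv_le _ _).trans_lt (by omega)
  constructor
  · have := co n
    rw [h3, hcoeff, mul_zero] at this
    have hn1 : (n + 1 : k) ≠ 0 := by exact_mod_cast Nat.succ_ne_zero n
    simpa [ha, hn1] using this
  · have h4 : (taylor b h).coeff (n + 1) = 1 := by
      rw [← Nat.succ_eq_add_one, ← hn, ← natDegree_taylor h b, coeff_natDegree, leadingCoeff_taylor]
      exact hmonic
    have := co (n + 1)
    rw [h4, hlead] at this
    simp [hn] at this ⊢
    exact this.symm

/-- Surjectivity forces `φ(t)` to have degree `1` in `t`: otherwise `t` would not be among the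
polynomials in `φ(t)` with coefficients in `φ(k[x]) ⊆ k[x]`. -/
theorem natDegree_symbol_map_t (hN : h.natDegree ≠ 0) (φ : OreAlg h ≃ₐ[k] OreAlg h) :
    (symbol h (φ (t h))).natDegree = 1 := by
  obtain ⟨p, hp, -⟩ := exists_map_x_eq_aeval hN φ
  set v := symbol h (φ.symm (t h)) with hv
  -- `t` is a polynomial of degree `deg v` in `φ(t)` with left coefficients in `k[x]`
  have e : t h = eval₂ (aeval (x h) : k[X] →ₐ[k] OreAlg h).toRingHom (φ (t h))
      (v.map (aeval p : k[X] →ₐ[k] k[X]).toRingHom) := by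
    have e1 := congrArg φ (eval₂_symbol h (φ.symm (t h)))
    have e2 := hom_eval₂ v (aeval (x h) : k[X] →ₐ[k] OreAlg h).toRingHom
      (φ : OreAlg h →ₐ[k] OreAlg h).toRingHom (t h)
    rw [AlgEquiv.apply_symm_apply] at e1
    refine e1.symm.trans (e2.trans ?_)
    rw [eval₂_map]
    congr 1
    ext c
    · simp
    · simp [hp]
  have := congrArg (fun u => (symbol h u).natDegree) e
  simp only [symbol_t, natDegree_X, natDegree_symbol_eval₂] at this
  exact Nat.eq_one_of_mul_eq_one_left this.symm

/-- Every automorphism of `A_h` has the form `σ_r ∘ τ_a`, with `a` preserving `h` up to the factor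
`a^N`. -/
theorem exists_map_eq [CharZero k] (hN : h.natDegree ≠ 0) (hmonic : h.Monic)
    (hcoeff : h.coeff (h.natDegree - 1) = 0) (φ : OreAlg h ≃ₐ[k] OreAlg h) :
    ∃ (a : kˣ) (r : k[X]), φ (x h) = (a : k) • x h ∧
      φ (t h) = (a : k) ^ (h.natDegree - 1) • (t h + aeval (x h) r) ∧
      h.comp (C (a : k) * X) = C ((a : k) ^ h.natDegree) * h := by
  have hh : h ≠ 0 := hmonic.ne_zero
  have h0 := aeval_x_ne_zero (h := h) hh
  obtain ⟨p, hp, hp1⟩ := exists_map_x_eq_aeval hN φ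
  obtain ⟨b', -, hb, -⟩ := exists_map_h_eq_mul hh φ
  obtain ⟨a, ha, b, rfl⟩ : ∃ a, a ≠ 0 ∧ ∃ b, p = C a * X + C b :=
    ⟨p.coeff 1, by
      rw [← hp1, coeff_natDegree]; exact leadingCoeff_ne_zero.mpr (by rintro rfl; simp at hp1),
      p.coeff 0, eq_X_add_C_of_natDegree_le_one hp1.le⟩
  have hφh : φ (aeval (x h) h) = aeval (x h) (h.comp (C a * X + C b)) := by
    rw [aeval_comp, ← hp, aeval_algHom_apply φ]
  -- the cofactor of `h` in `φ(h)` lies in `k[x]` and has degree `0` in `x`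
  obtain ⟨c, hc⟩ : ∃ c, h.comp (C a * X + C b) = C c * h := by
    obtain ⟨q, hq⟩ : ∃ q, b' = aeval (x h) q := by
      apply exists_eq_aeval_of_natDegree_symbol_eq_zero
      rw [hφh] at hb
      have := congrArg (symbol h) hb
      rw [symbol_aeval_x_mul, symbol_aeval_x] at this
      by_cases hb0 : symbol h b' = 0
      · simp [hb0]
      · have h1 := natDegree_mul (C_ne_zero.mpr hh) hb0
        rw [← this, natDegree_C, natDegree_C] at h1
        omega
    rw [hφh, hq, ← map_mul] at hb
    have hb := aeval_x_injective h hb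
    have hq0 : q ≠ 0 := by
      rintro rfl
      rw [hb, mul_zero, map_zero] at hφh
      exact h0 ((map_eq_zero_iff φ φ.injective).mp hφh)
    have hd := congrArg natDegree hb
    rw [natDegree_comp, hp1, mul_one, natDegree_mul hh hq0] at hd
    obtain ⟨c, rfl⟩ := natDegree_eq_zero.mp (show q.natDegree = 0 by omega)
    exact ⟨c, by rw [hb, mul_comm]⟩
  obtain ⟨rfl, rfl⟩ := eq_zero_of_comp_eq_smul hN hmonic hcoeff ha hc
  rw [C_0, add_zero] at *
  have hx : φ (x h) = a • x h := by rw [hp, map_mul, aeval_C, aeval_X, Algebra.smul_def]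
  obtain ⟨q, s, hqs⟩ : ∃ q s : k[X], φ (t h) = aeval (x h) q * t h + aeval (x h) s := by
    have h1 := eval₂_symbol h (φ (t h))
    rw [eq_X_add_C_of_natDegree_le_one (natDegree_symbol_map_t hN φ).le] at h1
    refine ⟨(symbol h (φ (t h))).coeff 1, (symbol h (φ (t h))).coeff 0, ?_⟩
    nth_rw 1 [← h1]
    simp [eval₂_add, eval₂_monomial, C_mul_X_eq_monomial]
  -- compare `[φ(t), φ(x)] = a q h` with `φ(h) = a^N h`
  have hq : q = C (a ^ (h.natDegree - 1)) := by
    have h1 := map_t_mul_map_x φ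
    have h2 : aeval (x h) s * x h = x h * aeval (x h) s := by
      have := congrArg (aeval (x h)) (mul_comm s X)
      simpa using this
    have h3 : aeval (x h) q * x h = x h * aeval (x h) q := by
      have := congrArg (aeval (x h)) (mul_comm q X)
      simpa using this
    rw [hφh, hc, hx, hqs, mul_smul_comm, smul_mul_assoc, add_mul, mul_add, mul_assoc, t_mul_x,
      mul_add, ← mul_assoc, ← mul_assoc, h2, h3, add_right_comm, smul_add] at h1
    have h4 := add_left_cancel h1
    rw [← map_mul, ← map_smul] at h4
    have h5 := aeval_x_injective h h4
    obtain ⟨n, hn⟩ := Nat.exists_eq_succ_of_ne_zero hN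
    rw [smul_eq_C_mul, ← mul_assoc] at h5
    have h6 := mul_right_cancel₀ hh h5
    rw [hn, pow_succ', C_mul] at h6
    rw [hn, Nat.succ_sub_one]
    exact mul_left_cancel₀ (C_ne_zero.mpr ha) h6
  refine ⟨Units.mk0 a ha, C ((a ^ (h.natDegree - 1))⁻¹) * s, hx, ?_, hc⟩
  rw [hqs, hq, Units.val_mk0, smul_add, map_mul, aeval_C, aeval_C, ← Algebra.smul_def,
    ← Algebra.smul_def, smul_smul, mul_inv_cancel₀ (pow_ne_zero _ ha), one_smul]

/-! ### The semidirect product -/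

/-- The endomorphism `σ_r ∘ τ_a` of `A_h`, that is, `x ↦ a x` and `t ↦ a^(N-1) (t + r(x))`. -/
noncomputable def affineHom (hN : h.natDegree ≠ 0) (a : k)
    (ha : h.comp (C a * X) = C (a ^ h.natDegree) * h) (r : k[X]) : OreAlg h →ₐ[k] OreAlg h :=
  lift h (a • x h) (a ^ (h.natDegree - 1) • (t h + aeval (x h) r)) (by
    have h1 : aeval (a • x h) h = a ^ h.natDegree • aeval (x h) h := by
      have := congrArg (aeval (x h)) ha
      simpa [aeval_comp, Algebra.smul_def] using this
    have h2 : aeval (x h) r * x h = x h * aeval (x h) r := by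
      have := congrArg (aeval (x h)) (mul_comm r X)
      simpa using this
    obtain ⟨n, hn⟩ := Nat.exists_eq_succ_of_ne_zero hN
    rw [h1, hn, Nat.succ_sub_one, smul_mul_smul_comm, smul_mul_smul_comm, add_mul, mul_add, t_mul_x,
      h2, pow_succ, mul_comm a, ← smul_add, add_right_comm])

section affineHom

variable (hN : h.natDegree ≠ 0) (a : k) (ha : h.comp (C a * X) = C (a ^ h.natDegree) * h)
  (r : k[X])

@[simp] theorem affineHom_x : affineHom hN a ha r (x h) = a • x h := by simp [affineHom]

@[simp] theorem affineHom_t :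
    affineHom hN a ha r (t h) = a ^ (h.natDegree - 1) • (t h + aeval (x h) r) := by
  simp [affineHom]

end affineHom

variable {G : Type*} [Group G] {ι : G →* kˣ}

/-- `(r, a) ↦ σ_r ∘ τ_a`, as a homomorphism to the monoid of endomorphisms of `A_h`. -/
noncomputable def semidirectHom (hN : h.natDegree ≠ 0)
    (hι : ∀ a, h.comp (C (ι a : k) * X) = C ((ι a : k) ^ h.natDegree) * h) :
    Multiplicative k[X] ⋊[(dilationAction k h.natDegree).comp ι] G →*
      (OreAlg h →ₐ[k] OreAlg h) where
  toFun g := affineHom hN (ι g.right) (hι _) g.left.toAdd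
  map_one' := by
    apply algHom_ext <;> simp
  map_mul' g g' := by
    apply algHom_ext
    · simp [smul_smul, mul_comm]
    · obtain ⟨n, hn⟩ := Nat.exists_eq_succ_of_ne_zero hN
      obtain ⟨r, a⟩ := g
      obtain ⟨s, b⟩ := g'
      have key : (ι a : k) ^ n • aeval (x h) (dilation h.natDegree (ι a) s.toAdd)
          = aeval ((ι a : k) • x h) s.toAdd := by
        have e : (ι a : k) ^ n * ((ι a ^ (1 - ((n + 1 : ℕ) : ℤ)) : kˣ) : k) = 1 := by
          rw [← Units.val_pow_eq_pow_val, ← Units.val_mul, ← zpow_natCast, ← zpow_add]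
          simp
        simp only [dilation, AddEquiv.coe_mk, Equiv.coe_fn_mk, hn, map_mul, aeval_C, aeval_comp,
          aeval_X, ← Algebra.smul_def, smul_smul, Nat.succ_eq_add_one, e, one_smul]
      simp only [affineHom_t, SemidirectProduct.mul_left, SemidirectProduct.mul_right,
        MonoidHom.comp_apply, toAdd_mul, map_add, map_mul, Units.val_mul, AlgHom.mul_apply,
        map_smul, ← aeval_algHom_apply, affineHom_x, hn, Nat.succ_sub_one, ← key, mul_pow,
        ← smul_add, add_assoc, smul_smul]
      rw [mul_comm]
      rfl

/-- Surjectivity onto `Aut(A_h)` is `exists_map_eq`; injectivity is read off from the images of `x`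
and `t`. -/
theorem autEqSemidirect_of_range [CharZero k] (hN : h.natDegree ≠ 0) (hmonic : h.Monic)
    (hcoeff : h.coeff (h.natDegree - 1) = 0) (hinj : Function.Injective ι)
    (hι : ∀ a : kˣ, a ∈ ι.range ↔ h.comp (C (a : k) * X) = C ((a : k) ^ h.natDegree) * h) :
    AutEqSemidirect h ι := by
  have hι' (a : G) := (hι (ι a)).mp ⟨a, rfl⟩
  let E := (AlgEquiv.algHomUnitsEquiv k (OreAlg h)).toMonoidHom.comp
    (semidirectHom hN hι').toHomUnits
  have Ex (g) : E g (x h) = (ι g.right : k) • x h := affineHom_x hN _ (hι' _) _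
  have Et (g) : E g (t h) = (ι g.right : k) ^ (h.natDegree - 1) •
      (t h + aeval (x h) g.left.toAdd) := affineHom_t hN _ (hι' _) _
  have inj : Function.Injective E := by
    intro g g' e
    have e1 := congrArg (fun φ => symbol h (φ (x h))) e
    have e2 := congrArg (fun φ => φ (t h)) e
    simp only [Ex, Et] at e1 e2
    -- the scalar `ι a` is the coefficient of `x` in the normal form of the image of `x`
    have sx : symbol h (x h) = C X := by simpa using symbol_aeval_x h X
    rw [map_smul, map_smul, sx] at e1
    have ha : g.right = g'.right := by
      apply hinj
      ext
      have := congrArg (fun v => (v.coeff 0).coeff 1) e1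
      simpa using this
    rw [ha] at e2
    have e3 := add_left_cancel (smul_right_injective _ (pow_ne_zero _ (Units.ne_zero _)) e2)
    exact SemidirectProduct.ext (aeval_x_injective h e3) ha
  have surj : Function.Surjective E := by
    intro φ
    obtain ⟨a, r, hx, ht, ha⟩ := exists_map_eq hN hmonic hcoeff φ
    obtain ⟨a, rfl⟩ := (hι a).mpr ha
    refine ⟨⟨Multiplicative.ofAdd r, a⟩, AlgEquiv.coe_toAlgHom_injective (algHom_ext ?_ ?_)⟩
    · exact (Ex _).trans hx.symm
    · exact (Et _).trans ht.symm
  refine ⟨MulEquiv.ofBijective E ⟨inj, surj⟩, fun r => ⟨(Ex _).trans ?_, (Et _).trans ?_⟩,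
    fun a => ⟨Ex _, (Et _).trans ?_⟩⟩ <;> simp

/-- Comparison of the coefficients: `cᵢ aⁱ = a^N cᵢ` for all `i`. -/
theorem comp_C_mul_X_eq_iff (h : k[X]) (a : kˣ) :
    h.comp (C (a : k) * X) = C ((a : k) ^ h.natDegree) * h ↔
      a ∈ ⨅ i ∈ h.support, rootsOfUnity (h.natDegree - i) k := by
  simp only [Polynomial.ext_iff, comp_C_mul_X_coeff, coeff_C_mul, Subgroup.mem_iInf,
    mem_rootsOfUnity, mem_support_iff]
  refine forall_congr' fun i => ?_
  by_cases hi : h.coeff i = 0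
  · simp [hi]
  have e : (a : k) ^ h.natDegree = (a : k) ^ i * (a : k) ^ (h.natDegree - i) := by
    rw [← pow_add, Nat.add_sub_cancel' (le_natDegree_of_ne_zero hi)]
  have ha : (a : k) ^ i ≠ 0 := pow_ne_zero _ a.ne_zero
  rw [e, mul_comm, mul_left_inj' hi, eq_comm, mul_eq_left₀ ha, forall_prop_of_true hi, Units.ext_iff,
    Units.val_pow_eq_pow_val, Units.val_one]

theorem iInf_rootsOfUnity_eq_gcd (S : Finset ℕ) (N : ℕ) :
    ⨅ i ∈ S, rootsOfUnity (N - i) k = rootsOfUnity ((S.erase N).gcd fun i => N - i) k := by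
  ext a
  simp only [Subgroup.mem_iInf, mem_rootsOfUnity, ← orderOf_dvd_iff_pow_eq_one,
    Finset.dvd_gcd_iff, Finset.mem_erase]
  refine ⟨fun H i hi => H i hi.2, fun H i hi => ?_⟩
  rcases eq_or_ne i N with rfl | hne
  · simp
  · exact H i ⟨hne, hi⟩

end OreAlg

theorem mainTheorem3 {k : Type*} [Field k] [IsAlgClosed k] [CharZero k]
    (h : k[X]) (N : ℕ) (hN : 1 ≤ N) (hdeg : h.natDegree = N) (hmonic : h.Monic)
    (hcoeff : h.coeff (N - 1) = 0) :
    (h = X ^ N → AutEqSemidirect h (MonoidHom.id kˣ)) ∧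
    (h ≠ X ^ N →
      AutEqSemidirect h (⨅ i ∈ h.support, rootsOfUnity (N - i) k).subtype ∧
      (⨅ i ∈ h.support, rootsOfUnity (N - i) k)
        = rootsOfUnity ((h.support.erase N).gcd fun i => N - i) k ∧
      AutEqSemidirect h (rootsOfUnity ((h.support.erase N).gcd fun i => N - i) k).subtype) := by
  subst hdeg
  have hN0 : h.natDegree ≠ 0 := by omega
  have hsub : AutEqSemidirect h (⨅ i ∈ h.support, rootsOfUnity (h.natDegree - i) k).subtype :=
    OreAlg.autEqSemidirect_of_range hN0 hmonic hcoeff (Subgroup.subtype_injective _) fun a => by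
      rw [Subgroup.range_subtype, OreAlg.comp_C_mul_X_eq_iff]
  refine ⟨fun hX => ?_, fun _ => ⟨hsub, OreAlg.iInf_rootsOfUnity_eq_gcd _ _, ?_⟩⟩
  · refine OreAlg.autEqSemidirect_of_range hN0 hmonic hcoeff Function.injective_id fun a => ?_
    refine ⟨fun _ => ?_, fun _ => ⟨a, rfl⟩⟩
    generalize h.natDegree = N at hX
    subst hX
    simp [mul_pow]
  · rwa [OreAlg.iInf_rootsOfUnity_eq_gcd] at hsub
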